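/- For $\underline N=(N_1,\dots,N_r)$ with integers $N_i\ge 1$ put $m=N_1\cdots N_r$, let $e_1,\dots,e_m$ be the monomials in $r$ variables $z^{(1)},\dots,z^{(r)}$ of degree at most $N_i-1$ in $z^{(i)}$ for every $i$, ordered degree-lexicographically, and for points $\underline z_1,\dots,\underline z_m\in\mathbb C^r$ let $V_{\underline N}(\underline z_1,\dots,\underline z_m)=(e_j(\underline z_i))_{1\le i,j\le m}$ be the multivariable Vandermonde matrix. Let $D_{\underline N}$ be the total degree of $\det V_{\underline N}$ as a polynomial in the coordinates of all the $\underline z_i$. For $K\subset\mathbb C^r$ compact and $\underline w=(w_1,\dots,w_r)$ a vector of positive rational numbers let $$t_{\underline w}(K)=\lim_{N\to\infty}\ \sup_{\underline z_1,\dots,\underline z_\ell\in K}\left|\det V_{(w_1N,\dots,w_rN)}(\underline z_1,\dots,\underline z_\ell)\right|^{1/D_{(w_1N,\dots,w_rN)}},\qquad \ell=w_1\cdots w_rN^r,$$ if the limit exists, where $N$ runs over the positive integers divisible by the common denominator of $w_1,\dots,w_r$. Likewise let $$t_r(K)=\lim_{N\to\infty}\ \sup_{\underline z_1,\dots,\underline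 z_{N^r}\in K}\left|\det V_{(N,\dots,N)}(\underline z_1,\dots,\underline z_{N^r})\right|^{1/D_N},\qquad D_N=\tfrac r2N^r(N-1).$$ (In $0$ variables the determinant is $1$, and the transfinite diameter of the point $\mathbb C^0$ is taken to be $1$.) Write $|\underline w|$ for the sum of the entries of $\underline w$. **Theorem.** Let $r\ge 1$ and $0\le k\le r$, and let $K_1\subset\mathbb C^k$ and $K_2\subset\mathbb C^{r-k}$ be nonempty compact sets and $K=K_1\times K_2\subset\mathbb C^r$. Let $\underline w=(w_1,\dots,w_r)$ be a vector of positive rational numbers, $\underline w'=(w_1,\dots,w_k)$ and $\underline w''=(w_{k+1},\dots,w_r)$. If the limits defining $t_{\underline w}(K)$, $t_{\underline w'}(K_1)$ and $t_{\underline w''}(K_2)$ exist, then $$t_{\underline w}(K)=t_{\underline w'}(K_1)^{|\underline w'|/|\underline w|}\cdot t_{\underline w''}(K_2)^{|\underline w''|/|\underline w|}.$$ In particular, if the limits defining $t_r(K)$, $t_k(K_1)$ and $t_{r-k}(K_2)$ exist, then $$t_r(K)=t_k(K_1)^{k/r}\cdot t_{r-k}(K_2)^{(r-k)/r}.$$ 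-/

import Mathlib

open Filter Topology

/-- The exponent vectors of the monomials in `r` variables of degree at most `N i - 1` in the
`i`-th variable. -/
def exponentBox {r : ℕ} (N : Fin r → ℕ) : Finset (Fin r → ℕ) :=
  Fintype.piFinset fun i => Finset.range (N i)

/-- The degree-lexicographic sorting key of a monomial: first the total degree (increasing), then,
within each degree, the lexicographic order in which `z⁽¹⁾` comes before `z⁽²⁾`, and so on
(thus `1, x, y, x², xy, y²`), i.e. the exponent vectors are lexicographically decreasing. -/
def degLexKey {r : ℕ} (a : Fin r → ℕ) : ℕ ×ₗ (Lex (Fin r → ℕ))ᵒᵈ :=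
  toLex (∑ i, a i, OrderDual.toDual (toLex a))

theorem degLexKey_injective {r : ℕ} : Function.Injective (degLexKey (r := r)) :=
  fun _ _ h => congrArg
    (fun p : ℕ ×ₗ (Lex (Fin r → ℕ))ᵒᵈ => ofLex (OrderDual.ofDual (ofLex p).2)) h

/-- The sorting keys of the monomials indexed by `exponentBox N`. -/
def degLexBox {r : ℕ} (N : Fin r → ℕ) : Finset (ℕ ×ₗ (Lex (Fin r → ℕ))ᵒᵈ) :=
  (exponentBox N).map ⟨degLexKey, degLexKey_injective⟩

theorem card_degLexBox {r : ℕ} (N : Fin r → ℕ) : (degLexBox N).card = ∏ i, N i := by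
  simp [degLexBox, exponentBox]

/-- The exponent vector of the `j`-th monomial `e_j` in the degree-lexicographically ordered list
of the `∏ i, N i` monomials of degree at most `N i - 1` in the `i`-th variable. -/
noncomputable def monomialExponent {r : ℕ} (N : Fin r → ℕ) (j : Fin (∏ i, N i)) : Fin r → ℕ :=
  ofLex (OrderDual.ofDual (ofLex ((degLexBox N).orderEmbOfFin (card_degLexBox N) j)).2)

/-- The multivariable Vandermonde matrix `V_N(z_1, …, z_m) = (e_j(z_i))`, `m = ∏ i, N i`. -/
noncomputable def multiVandermonde {R : Type*} [CommRing R] {r : ℕ} (N : Fin r → ℕ)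
    (z : Fin (∏ i, N i) → Fin r → R) : Matrix (Fin (∏ i, N i)) (Fin (∏ i, N i)) R :=
  Matrix.of fun i j => ∏ s, z i s ^ monomialExponent N j s

/-- The total degree of the multivariable Vandermonde determinant, as a polynomial in the
coordinates of all the points `z_i`. -/
noncomputable def vandermondeDegree {r : ℕ} (N : Fin r → ℕ) : ℕ :=
  (multiVandermonde N fun i s =>
    (MvPolynomial.X (i, s) : MvPolynomial (Fin (∏ i, N i) × Fin r) ℂ)).det.totalDegree

/-- The vector `(w_1 N, …, w_r N)`. The floor does nothing when all the `w_i N` are nonnegative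
integers, which is the only case in which this is used. -/
def scaledWeights {r : ℕ} (w : Fin r → ℚ) (N : ℕ) : Fin r → ℕ :=
  fun i => ⌊w i * (N : ℚ)⌋₊

/-- `N → ∞` along those `N` that are divisible by the denominators of all the weights. -/
def weightFilter {r : ℕ} (w : Fin r → ℚ) : Filter ℕ :=
  atTop ⊓ 𝓟 {N : ℕ | ∀ i, (w i).den ∣ N}

/-- The limit defining the weighted transfinite diameter `t_w(K)` exists and equals `t`. -/
def IsWeightedTransfiniteDiameter {r : ℕ} (w : Fin r → ℚ) (K : Set (Fin r → ℂ)) (t : ℝ) : Prop :=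
  Tendsto
    (fun N : ℕ => ⨆ z : Fin (∏ i, scaledWeights w N i) → K,
      ‖(multiVandermonde (scaledWeights w N) fun i => (z i : Fin r → ℂ)).det‖ ^
        (1 / (vandermondeDegree (scaledWeights w N) : ℝ)))
    (weightFilter w) (𝓝 t)

/-- The limit defining the transfinite diameter `t_r(K)` exists and equals `t`; the exponent is
`1 / D_N` with `D_N = (r / 2) N ^ r (N - 1)`. -/
def IsTransfiniteDiameter {r : ℕ} (K : Set (Fin r → ℂ)) (t : ℝ) : Prop :=
  Tendsto
    (fun N : ℕ => ⨆ z : Fin (∏ _i : Fin r, N) → K,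
      ‖(multiVandermonde (fun _ => N) fun i => (z i : Fin r → ℂ)).det‖ ^
        (1 / ((r : ℝ) / 2 * (N : ℝ) ^ r * ((N : ℝ) - 1))))
    atTop (𝓝 t)

/-- The product `K₁ × K₂` as a subset of `ℂ^(k + l) = ℂ^k × ℂ^l`. -/
def productSet {k l : ℕ} (K₁ : Set (Fin k → ℂ)) (K₂ : Set (Fin l → ℂ)) :
    Set (Fin (k + l) → ℂ) :=
  {z | (fun i => z (Fin.castAdd l i)) ∈ K₁ ∧ (fun j => z (Fin.natAdd k j)) ∈ K₂}

/-! On `K₁ × K₂` the monomials of a box are the products `φ_a(x) ψ_b(y)` of monomials of the two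
smaller boxes. With `m₁`, `m₂` the sizes of these boxes, `m = m₁ m₂`, and `s`, `s₁`, `s₂` the
suprema of the determinants, `supDet_tensor_bounds` gives `s₁ ^ m₂ * s₂ ^ m₁ ≤ s ≤ m! * s₁ ^ m₂ * s₂
^ m₁`. The lower bound evaluates on a grid of Fekete points, where the matrix is a Kronecker
product. For the upper bound, Lagrange interpolation at these points, with coefficients of modulus
at most 1, factors any matrix through the grid matrix. The determinant has degree `D = m S / 2` with
`S = ∑ (N_i - 1)` (`vandermondeDegree_eq`). Hence `m₂ / D = (1 / D₁) (S₁ / S)`, where `S₁ / S` tends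
to `|w'| / |w|`, and similarly for the second factor. Finally `(m!) ^ (1 / D) → 1`
(`tendsto_factorial_rpow`), so both bounds have the same limit (`eq_mul_of_tendsto_supDet`). -/

/-- The matrix `(φ_a(x_i))` of values of a family of functions at a family of points. -/
def valueMatrix {ι A X : Type*} (φ : A → X → ℂ) (x : ι → X) : Matrix ι A ℂ :=
  Matrix.of fun i a => φ a (x i)

/-- The supremum of `|det (φ_a(x_i))|` over all families of points. -/
noncomputable def supDet {A X : Type*} [Fintype A] [DecidableEq A] (φ : A → X → ℂ) : ℝ :=
  ⨆ x : A → X, ‖(valueMatrix φ x).det‖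

theorem ciSup_eq_of_forall_le {ι : Type*} {f : ι → ℝ} {i₀ : ι} (h : ∀ i, f i ≤ f i₀) :
    ⨆ i, f i = f i₀ :=
  haveI : Nonempty ι := ⟨i₀⟩
  le_antisymm (ciSup_le h) (le_ciSup ⟨f i₀, Set.forall_mem_range.2 h⟩ i₀)

/-! ### Suprema of determinants for products of families of functions -/

section

variable {A B X Y : Type*} [Fintype A] [DecidableEq A] [Fintype B] [DecidableEq B]

theorem supDet_nonneg (φ : A → X → ℂ) : 0 ≤ supDet φ :=
  Real.iSup_nonneg fun _ => norm_nonneg _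

/-- Rows and columns are permuted by the same bijection, so the determinant keeps even its sign.
This makes the ordering of the monomials irrelevant. -/
theorem supDet_congr (e : A ≃ B) (f : X ≃ Y) (φ : A → X → ℂ) (ψ : B → Y → ℂ)
    (h : ∀ a x, φ a x = ψ (e a) (f x)) : supDet φ = supDet ψ := by
  unfold supDet
  refine Equiv.iSup_congr (e.arrowCongr f) fun x => ?_
  have : valueMatrix φ x = (valueMatrix ψ (e.arrowCongr f x)).submatrix e e := by
    ext i a
    simp [valueMatrix, h]
  rw [this, Matrix.det_submatrix_equiv_self]

theorem exists_fekete [TopologicalSpace X] [CompactSpace X] [Nonempty X] (φ : A → X → ℂ)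
    (hφ : ∀ a, Continuous (φ a)) :
    ∃ x : A → X, ∀ y : A → X, ‖(valueMatrix φ y).det‖ ≤ ‖(valueMatrix φ x).det‖ := by
  have hc : Continuous fun y : A → X => ‖(valueMatrix φ y).det‖ := by
    refine (Continuous.matrix_det ?_).norm
    exact continuous_matrix fun i a => (hφ a).comp (continuous_apply i)
  obtain ⟨x, -, hx⟩ := isCompact_univ.exists_isMaxOn Set.univ_nonempty hc.continuousOn
  exact ⟨x, fun y => hx (Set.mem_univ y)⟩

/-- Lagrange interpolation at a Fekete configuration. -/
theorem exists_interpolation (φ : A → X → ℂ) (x : A → X)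
    (hmax : ∀ y : A → X, ‖(valueMatrix φ y).det‖ ≤ ‖(valueMatrix φ x).det‖)
    (hx : (valueMatrix φ x).det ≠ 0) :
    ∃ L : X → A → ℂ, (∀ y i, ‖L y i‖ ≤ 1) ∧ ∀ a y, φ a y = ∑ i, L y i * φ a (x i) := by
  set M := valueMatrix φ x with hM
  -- By Cramer's rule the `i`-th coefficient is the quotient by `det M` of the determinant with `x
  -- i` replaced by `y`; maximality at `x` bounds it by 1.
  refine ⟨fun y i => Matrix.cramer M.transpose (fun a => φ a y) i / M.det, fun y i => ?_,
    fun a y => ?_⟩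
  · have h : M.updateRow i (fun a => φ a y) = valueMatrix φ (Function.update x i y) := by
      ext j a
      by_cases hj : j = i
      · subst hj; simp [valueMatrix]
      · simp [valueMatrix, hM, hj]
    dsimp only
    rw [Matrix.cramer_transpose_apply, h, norm_div]
    exact div_le_one_of_le₀ (hmax _) (norm_nonneg _)
  · have h := congrFun (Matrix.mulVec_cramer M.transpose fun a => φ a y) a
    simp only [Matrix.mulVec, dotProduct, Matrix.transpose_apply, Matrix.det_transpose,
      Pi.smul_apply, smul_eq_mul] at h
    rw [eq_comm, mul_comm, ← eq_div_iff hx] at h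
    rw [h, Finset.sum_div]
    refine Finset.sum_congr rfl fun i _ => ?_
    simp only [hM, valueMatrix, Matrix.of_apply]
    ring

/-- If the vectors `(φ_a(y))_a` spanned `ℂ^A`, a basis chosen among them would give a nonzero
determinant. Otherwise a nonzero functional kills them all, and its coordinates are the relation. -/
theorem exists_relation (φ : A → X → ℂ) (h : ∀ x : A → X, (valueMatrix φ x).det = 0) :
    ∃ c : A → ℂ, c ≠ 0 ∧ ∀ y, ∑ a, φ a y * c a = 0 := by
  set S : Set (A → ℂ) := Set.range fun y a => φ a y with hS
  by_cases htop : Submodule.span ℂ S = ⊤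
  · exfalso
    obtain ⟨b, hbS, hb, hli⟩ := exists_linearIndependent ℂ S
    let bas : Module.Basis b ℂ (A → ℂ) := Module.Basis.mk hli (by
      rw [Subtype.range_coe, hb, htop])
    let e : A ≃ b := (Pi.basisFun ℂ A).indexEquiv bas
    have hmem : ∀ i : A, ∃ y, (fun a => φ a y) = ((e i : b) : A → ℂ) := fun i => hbS (e i).2
    choose x hx using hmem
    have hrow : LinearIndependent ℂ (valueMatrix φ x).row := by
      have h2 := hli.comp e e.injective
      have h3 : (valueMatrix φ x).row = (fun i : b => (i : A → ℂ)) ∘ e := by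
        funext i
        exact hx i
      rw [h3]; exact h2
    rw [Matrix.linearIndependent_rows_iff_isUnit, Matrix.isUnit_iff_isUnit_det, h x] at hrow
    exact not_isUnit_zero hrow
  · obtain ⟨f, hf, hle⟩ := Submodule.exists_le_ker_of_lt_top _ (lt_top_iff_ne_top.2 htop)
    have hfe : ∀ v : A → ℂ, f v = ∑ a, v a * f (Pi.single a 1) := fun v => by
      conv_lhs => rw [pi_eq_sum_univ' v]
      simp
    refine ⟨fun a => f (Pi.single a 1), fun h0 => hf ?_, fun y => ?_⟩
    · ext v
      simp [congrFun h0]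
    · rw [← hfe fun a => φ a y]
      exact hle (Submodule.subset_span ⟨y, rfl⟩)

/-- The products `φ_a(x) ψ_b(y)`. -/
def tensorFamily (φ : A → X → ℂ) (ψ : B → Y → ℂ) : A × B → X × Y → ℂ :=
  fun p z => φ p.1 z.1 * ψ p.2 z.2

theorem det_valueMatrix_grid (φ : A → X → ℂ) (ψ : B → Y → ℂ) (x : A → X) (y : B → Y) :
    (valueMatrix (tensorFamily φ ψ) fun p : A × B => (x p.1, y p.2)).det =
      (valueMatrix φ x).det ^ Fintype.card B * (valueMatrix ψ y).det ^ Fintype.card A := by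
  rw [← Matrix.det_kronecker]
  rfl

/-- Covers the degenerate case, where interpolation is unavailable: a relation among the `φ_a`,
multiplied by one fixed `ψ_{b₀}`, is a relation among the products. -/
theorem det_tensor_eq_zero_left [Nonempty B] (φ : A → X → ℂ) (ψ : B → Y → ℂ)
    (h : ∀ x : A → X, (valueMatrix φ x).det = 0) (z : A × B → X × Y) :
    (valueMatrix (tensorFamily φ ψ) z).det = 0 := by
  obtain ⟨c, hc, hrel⟩ := exists_relation φ h
  obtain ⟨a₀, ha₀⟩ := Function.ne_iff.1 hc
  obtain ⟨b₀⟩ := ‹Nonempty B›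
  refine Matrix.exists_mulVec_eq_zero_iff.1
    ⟨fun p => c p.1 * (Pi.single b₀ 1 : B → ℂ) p.2, fun h0 => ha₀ ?_, ?_⟩
  · simpa using congrFun h0 (a₀, b₀)
  · funext p
    have := hrel (z p).1
    simp only [Matrix.mulVec, dotProduct, valueMatrix, Matrix.of_apply, tensorFamily,
      Fintype.sum_prod_type, Pi.zero_apply]
    calc _ = ∑ a, φ a (z p).1 * c a * ψ b₀ (z p).2 :=
          Finset.sum_congr rfl fun a _ => by
            rw [Finset.sum_eq_single b₀ (fun b _ hb => by simp [hb]) (by simp)]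
            simp; ring
      _ = 0 := by rw [← Finset.sum_mul, this, zero_mul]

theorem det_tensor_eq_zero_right [Nonempty A] (φ : A → X → ℂ) (ψ : B → Y → ℂ)
    (h : ∀ y : B → Y, (valueMatrix ψ y).det = 0) (z : A × B → X × Y) :
    (valueMatrix (tensorFamily φ ψ) z).det = 0 := by
  have key := det_tensor_eq_zero_left ψ φ h fun p => (z p.swap).swap
  rw [← Matrix.det_submatrix_equiv_self (Equiv.prodComm A B)] at key
  convert key using 2
  ext p q
  simp [valueMatrix, tensorFamily, mul_comm]

variable [TopologicalSpace X] [CompactSpace X] [Nonempty X]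
  [TopologicalSpace Y] [CompactSpace Y] [Nonempty Y]

theorem supDet_tensor_bounds [Nonempty A] [Nonempty B] (φ : A → X → ℂ) (ψ : B → Y → ℂ)
    (hφ : ∀ a, Continuous (φ a)) (hψ : ∀ b, Continuous (ψ b)) :
    supDet φ ^ Fintype.card B * supDet ψ ^ Fintype.card A ≤ supDet (tensorFamily φ ψ) ∧
    supDet (tensorFamily φ ψ) ≤ (Fintype.card (A × B)).factorial *
      (supDet φ ^ Fintype.card B * supDet ψ ^ Fintype.card A) := by
  obtain ⟨x, hx⟩ := exists_fekete φ hφ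
  obtain ⟨y, hy⟩ := exists_fekete ψ hψ
  obtain ⟨z, hz⟩ := exists_fekete (tensorFamily φ ψ) fun p =>
    ((hφ p.1).comp continuous_fst).mul ((hψ p.2).comp continuous_snd)
  have e₁ : supDet φ = ‖(valueMatrix φ x).det‖ := ciSup_eq_of_forall_le hx
  have e₂ : supDet ψ = ‖(valueMatrix ψ y).det‖ := ciSup_eq_of_forall_le hy
  have e₃ : supDet (tensorFamily φ ψ) = _ := ciSup_eq_of_forall_le hz
  have hgrid := det_valueMatrix_grid φ ψ x y
  have hn := congrArg norm hgrid
  rw [norm_mul, norm_pow, norm_pow, ← e₁, ← e₂] at hn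
  refine ⟨?_, ?_⟩
  · rw [← hn, e₃]
    exact hz _
  rw [← hn, e₃]
  by_cases hx0 : (valueMatrix φ x).det = 0
  · rw [det_tensor_eq_zero_left φ ψ
      (fun x' => norm_le_zero_iff.1 ((hx x').trans (by simp [hx0]))) z, norm_zero]
    positivity
  by_cases hy0 : (valueMatrix ψ y).det = 0
  · rw [det_tensor_eq_zero_right φ ψ
      (fun y' => norm_le_zero_iff.1 ((hy y').trans (by simp [hy0]))) z, norm_zero]
    positivity
  obtain ⟨L, hL, hLφ⟩ := exists_interpolation φ x hx hx0
  obtain ⟨L', hL', hLψ⟩ := exists_interpolation ψ y hy hy0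
  -- Interpolating in both variables writes the matrix at `z` as a coefficient matrix times the grid
  -- matrix.
  have hfac : valueMatrix (tensorFamily φ ψ) z =
      (Matrix.of fun p q : A × B => L (z p).1 q.1 * L' (z p).2 q.2) *
        valueMatrix (tensorFamily φ ψ) fun p : A × B => (x p.1, y p.2) := by
    ext p q
    simp only [Matrix.mul_apply, valueMatrix, Matrix.of_apply, tensorFamily]
    rw [hLφ, hLψ, Finset.sum_mul_sum, Fintype.sum_prod_type]
    exact Finset.sum_congr rfl fun i _ => Finset.sum_congr rfl fun j _ => by ring
  rw [hfac, Matrix.det_mul, norm_mul]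
  refine mul_le_mul_of_nonneg_right ?_ (norm_nonneg _)
  -- The Leibniz expansion with entries of modulus at most 1 gives `m!`; this crude bound suffices
  -- after taking `D`-th roots.
  have hdet := Matrix.det_le (A := Matrix.of fun p q : A × B => L (z p).1 q.1 * L' (z p).2 q.2)
    (abv := NormedField.toAbsoluteValue ℂ) (x := 1) (fun p q => by
      show ‖L (z p).1 q.1 * L' (z p).2 q.2‖ ≤ 1
      rw [norm_mul]
      exact mul_le_one₀ (hL _ _) (norm_nonneg _) (hL' _ _))
  rw [one_pow, nsmul_eq_mul, mul_one] at hdet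
  exact hdet

end

/-! ### Monomials of a box and their splitting over a product set -/

theorem monomialExponent_spec {r : ℕ} (N : Fin r → ℕ) (j : Fin (∏ i, N i)) :
    monomialExponent N j ∈ exponentBox N ∧
      degLexKey (monomialExponent N j) = (degLexBox N).orderEmbOfFin (card_degLexBox N) j := by
  have h := (degLexBox N).orderEmbOfFin_mem (card_degLexBox N) j
  obtain ⟨a, ha, he⟩ := Finset.mem_map.1 h
  have h2 : monomialExponent N j = a := by
    unfold monomialExponent
    rw [← he]
    rfl
  rw [h2]
  exact ⟨ha, he⟩

theorem monomialExponent_injective {r : ℕ} (N : Fin r → ℕ) :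
    Function.Injective (monomialExponent N) := fun i j h => by
  have := congrArg degLexKey h
  rw [(monomialExponent_spec N i).2, (monomialExponent_spec N j).2] at this
  exact ((degLexBox N).orderEmbOfFin (card_degLexBox N)).injective this

/-- The enumeration of the exponent vectors by `monomialExponent`. -/
noncomputable def monomialEquiv {r : ℕ} (N : Fin r → ℕ) : Fin (∏ i, N i) ≃ exponentBox N :=
  Equiv.ofBijective (fun j => ⟨monomialExponent N j, (monomialExponent_spec N j).1⟩) <|
    (Fintype.bijective_iff_injective_and_card _).2
      ⟨fun i j h => monomialExponent_injective N (congrArg Subtype.val h), by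
        rw [Fintype.card_coe, Fintype.card_fin]; simp [exponentBox]⟩

theorem monomialEquiv_coe {r : ℕ} (N : Fin r → ℕ) (j : Fin (∏ i, N i)) :
    ((monomialEquiv N j : exponentBox N) : Fin r → ℕ) = monomialExponent N j := rfl

theorem mem_exponentBox {r : ℕ} {N a : Fin r → ℕ} : a ∈ exponentBox N ↔ ∀ i, a i < N i := by
  simp [exponentBox]

/-- Concatenation of exponent vectors. -/
def exponentBoxAppend {k l : ℕ} (N : Fin (k + l) → ℕ) :
    exponentBox N ≃ exponentBox (fun i => N (Fin.castAdd l i)) ×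
      exponentBox (fun j => N (Fin.natAdd k j)) where
  toFun a := (⟨fun i => a.1 (Fin.castAdd l i), mem_exponentBox.2 fun i => mem_exponentBox.1 a.2 _⟩,
    ⟨fun j => a.1 (Fin.natAdd k j), mem_exponentBox.2 fun i => mem_exponentBox.1 a.2 _⟩)
  invFun p := ⟨Fin.append p.1.1 p.2.1, mem_exponentBox.2 fun i => by
    refine Fin.addCases (fun i => ?_) (fun i => ?_) i
    · simpa using mem_exponentBox.1 p.1.2 i
    · simpa using mem_exponentBox.1 p.2.2 i⟩
  left_inv a := Subtype.ext (Fin.append_castAdd_natAdd)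
  right_inv p := by ext <;> simp

/-- The monomials of the box as functions on a set. -/
noncomputable def monomialFamily {r : ℕ} (N : Fin r → ℕ) (K : Set (Fin r → ℂ)) :
    Fin (∏ i, N i) → K → ℂ :=
  fun j z => ∏ s, (z : Fin r → ℂ) s ^ monomialExponent N j s

theorem continuous_monomialFamily {r : ℕ} (N : Fin r → ℕ) (K : Set (Fin r → ℂ))
    (j : Fin (∏ i, N i)) : Continuous (monomialFamily N K j) := by
  exact continuous_finsetProd _ fun s _ => ((continuous_apply s).comp continuous_subtype_val).pow _

/-- Points of `K₁ × K₂` as pairs. -/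
def productSetEquiv {k l : ℕ} (K₁ : Set (Fin k → ℂ)) (K₂ : Set (Fin l → ℂ)) :
    productSet K₁ K₂ ≃ K₁ × K₂ where
  toFun z := (⟨_, z.2.1⟩, ⟨_, z.2.2⟩)
  invFun p := ⟨Fin.append p.1.1 p.2.1, by simp [productSet]⟩
  left_inv z := Subtype.ext (Fin.append_castAdd_natAdd)
  right_inv p := by ext <;> simp

theorem supDet_productSet {k l : ℕ} (N : Fin (k + l) → ℕ) (K₁ : Set (Fin k → ℂ))
    (K₂ : Set (Fin l → ℂ)) :
    supDet (monomialFamily N (productSet K₁ K₂)) =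
      supDet (tensorFamily (monomialFamily (fun i => N (Fin.castAdd l i)) K₁)
        (monomialFamily (fun j => N (Fin.natAdd k j)) K₂)) := by
  refine supDet_congr (((monomialEquiv N).trans (exponentBoxAppend N)).trans
    ((monomialEquiv _).symm.prodCongr (monomialEquiv _).symm)) (productSetEquiv K₁ K₂) _ _
    fun j z => ?_
  simp only [tensorFamily, monomialFamily, ← monomialEquiv_coe, Equiv.trans_apply,
    Equiv.prodCongr_apply, Prod.map_fst, Prod.map_snd, Equiv.apply_symm_apply, Fin.prod_univ_add]
  rfl

/-- The supremum is attained at a Fekete configuration and `x ↦ x ^ p` is monotone on nonnegative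
reals, so the exponent leaves the supremum. -/
theorem iSup_multiVandermonde_rpow {r : ℕ} (N : Fin r → ℕ) {K : Set (Fin r → ℂ)}
    (hK : IsCompact K) (hne : K.Nonempty) {p : ℝ} (hp : 0 ≤ p) :
    ⨆ z : Fin (∏ i, N i) → K,
      ‖(multiVandermonde N fun i => (z i : Fin r → ℂ)).det‖ ^ p =
    supDet (monomialFamily N K) ^ p := by
  have := isCompact_iff_compactSpace.1 hK
  have := hne.to_subtype
  obtain ⟨x, hx⟩ := exists_fekete _ (continuous_monomialFamily N K)
  have e : supDet (monomialFamily N K) = _ := ciSup_eq_of_forall_le hx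
  rw [e]
  exact ciSup_eq_of_forall_le (i₀ := x)
    fun z => Real.rpow_le_rpow (norm_nonneg _) (hx z) hp

theorem supDet_monomialFamily_zero (N : Fin 0 → ℕ) {K : Set (Fin 0 → ℂ)} (hne : K.Nonempty) :
    supDet (monomialFamily N K) = 1 := by
  have := hne.to_subtype
  have h : ∀ z : Fin (∏ i, N i) → K, ‖(valueMatrix (monomialFamily N K) z).det‖ = 1 := fun z => by
    rw [Matrix.det_eq_elem_of_card_eq_one (by simp) ⟨0, by simp⟩]
    simp [valueMatrix, monomialFamily]
  simp [supDet, h]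

/-! ### Degree of the Vandermonde determinant -/

/-- The reflection `a ↦ N - 1 - a` permutes the box, and each exponent vector together with its
mirror image has total degree `∑ (N s - 1)`. If some `N s` is 0 the box is empty and both sides
vanish. -/
theorem two_mul_sum_exponentBox {r : ℕ} (N : Fin r → ℕ) :
    2 * ∑ a ∈ exponentBox N, ∑ s, a s = (∏ i, N i) * ∑ s, (N s - 1) := by
  have h : ∑ a ∈ exponentBox N, ∑ s, a s = ∑ a ∈ exponentBox N, ∑ s, (N s - 1 - a s) := by
    refine Finset.sum_nbij' (fun a s => N s - 1 - a s) (fun a s => N s - 1 - a s)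
      (fun a ha => ?_) (fun a ha => ?_) (fun a ha => ?_) (fun a ha => ?_) fun a ha => ?_
    all_goals rw [mem_exponentBox] at ha
    · exact mem_exponentBox.2 fun i => by have := ha i; omega
    · exact mem_exponentBox.2 fun i => by have := ha i; omega
    · funext i; have := ha i; dsimp only; omega
    · funext i; have := ha i; dsimp only; omega
    · exact Finset.sum_congr rfl fun i _ => by have := ha i; dsimp only; omega
  rw [two_mul]
  nth_rewrite 2 [h]
  rw [← Finset.sum_add_distrib]
  have h2 : ∀ a ∈ exponentBox N, ∑ s, a s + ∑ s, (N s - 1 - a s) = ∑ s, (N s - 1) := fun a ha => by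
    rw [← Finset.sum_add_distrib]
    exact Finset.sum_congr rfl fun i _ => by have := mem_exponentBox.1 ha i; omega
  rw [Finset.sum_congr rfl h2, Finset.sum_const, smul_eq_mul]
  simp [exponentBox]

/-- Every Leibniz term is a signed monomial of the same degree, so the determinant is homogeneous.
It is nonzero because no other permutation yields the monomial of the identity, which therefore
cannot cancel. -/
theorem vandermondeDegree_eq_sum {r : ℕ} (N : Fin r → ℕ) :
    vandermondeDegree N = ∑ a ∈ exponentBox N, ∑ s, a s := by
  classical
  set m := ∏ i, N i with hm
  let ex : Equiv.Perm (Fin m) → (Fin m × Fin r →₀ ℕ) := fun σ =>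
    Finsupp.equivFunOnFinite.symm fun p => monomialExponent N (σ p.1) p.2
  have hterm : ∀ σ : Equiv.Perm (Fin m),
      ∏ i, (multiVandermonde N fun i s =>
        (MvPolynomial.X (i, s) : MvPolynomial (Fin m × Fin r) ℂ)).transpose (σ i) i =
      MvPolynomial.monomial (ex σ) 1 := fun σ => by
    rw [MvPolynomial.monomial_eq, Finsupp.prod_fintype _ _ (by simp), Fintype.prod_prod_type]
    simp [multiVandermonde, ex]
  have hdet : (multiVandermonde N fun i s =>
      (MvPolynomial.X (i, s) : MvPolynomial (Fin m × Fin r) ℂ)).det =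
      ∑ σ : Equiv.Perm (Fin m), Equiv.Perm.sign σ • MvPolynomial.monomial (ex σ) (1 : ℂ) := by
    rw [← Matrix.det_transpose, Matrix.det_apply]
    exact Finset.sum_congr rfl fun σ _ => by rw [hterm]
  have hdeg : ∀ σ, (ex σ).degree = ∑ a ∈ exponentBox N, ∑ s, a s := fun σ => by
    rw [Finsupp.degree_eq_sum, Fintype.sum_prod_type]
    simp only [ex, Finsupp.equivFunOnFinite_symm_apply_apply]
    rw [Equiv.sum_comp σ fun j => ∑ s, monomialExponent N j s]
    exact (Equiv.sum_comp (monomialEquiv N) fun a => ∑ s, (a : Fin r → ℕ) s).trans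
      (Finset.sum_coe_sort (exponentBox N) fun a => ∑ s, a s)
  have hinj : ∀ σ, ex σ = ex 1 → σ = 1 := fun σ h => by
    ext i
    have : monomialExponent N (σ i) = monomialExponent N i := by
      funext s
      simpa [ex] using DFunLike.congr_fun h (i, s)
    rw [monomialExponent_injective N this]
    rfl
  unfold vandermondeDegree
  rw [hdet]
  refine MvPolynomial.IsHomogeneous.totalDegree (MvPolynomial.IsHomogeneous.sum _ _ _
    fun σ _ => ?_) fun h0 => ?_
  · have h1 := MvPolynomial.isHomogeneous_monomial (1 : ℂ) (hdeg σ)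
    rcases Int.units_eq_one_or (Equiv.Perm.sign σ) with h | h
    · rw [h, one_smul]; exact h1
    · rw [h, Units.neg_smul, one_smul]; exact h1.neg
  · have hc := congrArg (MvPolynomial.coeff (ex 1)) h0
    rw [MvPolynomial.coeff_sum, Finset.sum_eq_single 1 (fun σ _ hσ => ?_) (by simp)] at hc
    · simp at hc
    · rcases Int.units_eq_one_or (Equiv.Perm.sign σ) with h | h <;>
        simp [h, MvPolynomial.coeff_monomial, mt (hinj σ) hσ]

theorem vandermondeDegree_eq {r : ℕ} (N : Fin r → ℕ) (hN : ∀ i, 1 ≤ N i) :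
    (vandermondeDegree N : ℝ) = (∏ i, (N i : ℝ)) * (∑ i, ((N i : ℝ) - 1)) / 2 := by
  have h := two_mul_sum_exponentBox N
  rw [← vandermondeDegree_eq_sum] at h
  have h2 : (2 : ℝ) * vandermondeDegree N = (∏ i, (N i : ℝ)) * ∑ i, ((N i : ℝ) - 1) := by
    have := congrArg (Nat.cast : ℕ → ℝ) h
    push_cast [Nat.cast_sub (hN _)] at this
    exact this
  linarith

/-! ### Asymptotics and the squeeze -/

theorem tendsto_log_div_sub_one :
    Tendsto (fun n : ℕ => Real.log n / ((n : ℝ) - 1)) atTop (𝓝 0) := by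
  have h1 : Tendsto (fun x : ℝ => Real.log x / x) atTop (𝓝 0) :=
    Real.isLittleO_log_id_atTop.tendsto_div_nhds_zero
  -- The factor 2 comes from `n - 1 ≥ n / 2` for `n ≥ 2`.
  have h2 := (h1.const_mul 2).comp tendsto_natCast_atTop_atTop
  rw [mul_zero] at h2
  refine squeeze_zero' ?_ ?_ h2
  · filter_upwards [eventually_ge_atTop 2] with n hn
    have hn' : (2 : ℝ) ≤ n := by exact_mod_cast hn
    exact div_nonneg (Real.log_nonneg (by linarith)) (by linarith)
  · filter_upwards [eventually_ge_atTop 2] with n hn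
    have hn' : (2 : ℝ) ≤ n := by exact_mod_cast hn
    have hl : 0 ≤ Real.log n := Real.log_nonneg (by linarith)
    show _ ≤ 2 * (Real.log n / n)
    rw [div_le_iff₀ (by linarith)]
    have : 2 * (Real.log n / n) * ((n : ℝ) - 1) = Real.log n * (2 * (n - 1) / n) := by ring
    rw [this]
    refine le_mul_of_one_le_right hl ?_
    rw [le_div_iff₀ (by linarith)]
    linarith

/-- The degree of the determinant, as a real number. -/
noncomputable def boxDegree {r : ℕ} (N : Fin r → ℕ) : ℝ :=
  (∏ i, (N i : ℝ)) * (∑ i, ((N i : ℝ) - 1)) / 2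

/-- Factorials of the size of the determinant are negligible on the scale of its degree. -/
theorem tendsto_factorial_rpow {r : ℕ} (hr : 1 ≤ r) {F : Filter ℕ} {N : ℕ → Fin r → ℕ}
    (hN : ∀ i, Tendsto (fun n => N n i) F atTop) :
    Tendsto (fun n => ((∏ i, N n i).factorial : ℝ) ^ (1 / boxDegree (N n))) F (𝓝 1) := by
  have hlim : Tendsto (fun n => Real.exp (2 * ∑ i, Real.log (N n i) / ((N n i : ℝ) - 1)))
      F (𝓝 1) := by
    have h := (tendsto_finsetSum Finset.univ fun i _ =>
      tendsto_log_div_sub_one.comp (hN i)).const_mul 2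
    simp only [Finset.sum_const_zero, mul_zero] at h
    have h' := (Real.continuous_exp.tendsto 0).comp h
    rw [Real.exp_zero] at h'
    exact h'
  have hev : ∀ᶠ n in F, ∀ i, 2 ≤ N n i :=
    eventually_all.2 fun i => (hN i).eventually_ge_atTop 2
  refine tendsto_of_tendsto_of_tendsto_of_le_of_le' tendsto_const_nhds hlim ?_ ?_
  · filter_upwards [hev] with n hn
    have h1 : ∀ i, (1 : ℝ) ≤ (N n i : ℝ) - 1 := fun i => by
      have : (2 : ℝ) ≤ N n i := by exact_mod_cast hn i
      linarith
    refine Real.one_le_rpow (by exact_mod_cast Nat.factorial_pos _) ?_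
    have := Finset.sum_nonneg fun i (_ : i ∈ Finset.univ) => zero_le_one.trans (h1 i)
    unfold boxDegree
    positivity
  · filter_upwards [hev] with n hn
    have h1 : ∀ i, (1 : ℝ) ≤ (N n i : ℝ) - 1 := fun i => by
      have : (2 : ℝ) ≤ N n i := by exact_mod_cast hn i
      linarith
    have hlog : ∀ i, 0 ≤ Real.log (N n i) := fun i => Real.log_nonneg (by linarith [h1 i])
    set S := ∑ i, ((N n i : ℝ) - 1) with hS
    have hle : ∀ i, (N n i : ℝ) - 1 ≤ S := fun i =>
      Finset.single_le_sum (fun j _ => zero_le_one.trans (h1 j)) (Finset.mem_univ i)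
    have hSpos : 0 < S := zero_lt_one.trans_le ((h1 ⟨0, hr⟩).trans (hle _))
    have hmpos : 0 < ∏ i, N n i := Finset.prod_pos fun i _ => by have := hn i; omega
    set m := ∏ i, N n i with hm
    have hmR : (∏ i, (N n i : ℝ)) = m := by rw [hm]; push_cast; rfl
    have hm0 : (0 : ℝ) < m := by exact_mod_cast hmpos
    have hD : boxDegree (N n) = m * S / 2 := by rw [boxDegree, hmR]
    -- `m! ≤ m ^ m` and `D = m S / 2` give `exp (2 log m / S)`; then `log m = ∑ log N_i` and `S ≥
    -- N_i - 1` in each summand.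
    calc ((m.factorial : ℕ) : ℝ) ^ (1 / boxDegree (N n))
        ≤ ((m : ℝ) ^ m) ^ (1 / boxDegree (N n)) := by
          refine Real.rpow_le_rpow (by positivity) (by exact_mod_cast m.factorial_le_pow) ?_
          rw [hD]; positivity
      _ = Real.exp (2 * (Real.log m / S)) := by
          rw [← Real.rpow_natCast, ← Real.rpow_mul hm0.le, Real.rpow_def_of_pos hm0, hD]
          congr 1
          field_simp
      _ ≤ _ := by
          refine Real.exp_le_exp.2 (mul_le_mul_of_nonneg_left ?_ zero_le_two)
          rw [← hmR, Real.log_prod fun i _ => by linarith [h1 i], Finset.sum_div]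
          exact Finset.sum_le_sum fun i _ =>
            div_le_div_of_nonneg_left (hlog i) (by linarith [h1 i]) (hle i)

/-- This is the identity `M / D = (1 / D₁) (S₁ / S)` between exponents. For `r = 0` it fails, since
`D₁ = 0`, but then the base is 1. -/
theorem rpow_exponent_split {r : ℕ} {N : Fin r → ℕ} (hN : ∀ i, 2 ≤ N i) {K : Set (Fin r → ℂ)}
    (hne : K.Nonempty) {M : ℕ} (hM : M ≠ 0) {D S : ℝ} (hD : D = (∏ i, (N i : ℝ)) * M * S / 2) :
    (supDet (monomialFamily N K) ^ M) ^ (1 / D) =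
      (supDet (monomialFamily N K) ^ (1 / boxDegree N)) ^ ((∑ i, ((N i : ℝ) - 1)) / S) := by
  rcases Nat.eq_zero_or_pos r with rfl | hr
  · simp [supDet_monomialFamily_zero N hne]
  have h1 : ∀ i, (1 : ℝ) ≤ (N i : ℝ) - 1 := fun i => by
    have : (2 : ℝ) ≤ N i := by exact_mod_cast hN i
    linarith
  have hs : 0 < ∑ i, ((N i : ℝ) - 1) :=
    Finset.sum_pos (fun i _ => zero_lt_one.trans_le (h1 i)) ⟨⟨0, hr⟩, Finset.mem_univ _⟩
  have hp : 0 < ∏ i, (N i : ℝ) := Finset.prod_pos fun i _ => by linarith [h1 i]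
  rw [← Real.rpow_natCast, ← Real.rpow_mul (supDet_nonneg _), ← Real.rpow_mul (supDet_nonneg _)]
  congr 1
  rw [hD, boxDegree]
  have hM' : (M : ℝ) ≠ 0 := by exact_mod_cast hM
  field_simp

/-- Common core of the weighted and unweighted formulas, for box sizes growing along any nontrivial
filter. -/
theorem eq_mul_of_tendsto_supDet {k l : ℕ} (hr : 1 ≤ k + l)
    {K₁ : Set (Fin k → ℂ)} {K₂ : Set (Fin l → ℂ)}
    (hK₁ : IsCompact K₁) (hK₂ : IsCompact K₂) (hne₁ : K₁.Nonempty) (hne₂ : K₂.Nonempty)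
    {F : Filter ℕ} [F.NeBot] {N : ℕ → Fin (k + l) → ℕ}
    (hN : ∀ i, Tendsto (fun n => N n i) F atTop) {α β : ℝ}
    (hα : Tendsto (fun n => (∑ i, ((N n (Fin.castAdd l i) : ℝ) - 1)) / ∑ i, ((N n i : ℝ) - 1))
      F (𝓝 α))
    (hβ : Tendsto (fun n => (∑ j, ((N n (Fin.natAdd k j) : ℝ) - 1)) / ∑ i, ((N n i : ℝ) - 1))
      F (𝓝 β))
    (hα0 : k ≠ 0 → 0 < α) (hβ0 : l ≠ 0 → 0 < β) {t t₁ t₂ : ℝ}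
    (ht : Tendsto (fun n => supDet (monomialFamily (N n) (productSet K₁ K₂)) ^
      (1 / boxDegree (N n))) F (𝓝 t))
    (ht₁ : Tendsto (fun n => supDet (monomialFamily (fun i => N n (Fin.castAdd l i)) K₁) ^
      (1 / boxDegree fun i => N n (Fin.castAdd l i))) F (𝓝 t₁))
    (ht₂ : Tendsto (fun n => supDet (monomialFamily (fun j => N n (Fin.natAdd k j)) K₂) ^
      (1 / boxDegree fun j => N n (Fin.natAdd k j))) F (𝓝 t₂)) :
    t = t₁ ^ α * t₂ ^ β := by
  have := isCompact_iff_compactSpace.1 hK₁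
  have := isCompact_iff_compactSpace.1 hK₂
  have := hne₁.to_subtype
  have := hne₂.to_subtype
  -- Joint continuity of `x ^ y` at `(t₁, α)` requires `t₁ ≠ 0` or `0 < α`. The exponent is positive
  -- unless `k = 0`, and in that case `t₁ = 1`.
  have base₁ : t₁ ≠ 0 ∨ 0 < α := by
    rcases eq_or_ne k 0 with rfl | h
    · refine Or.inl fun h0 => ?_
      simp only [supDet_monomialFamily_zero _ hne₁, Real.one_rpow] at ht₁
      exact one_ne_zero ((tendsto_nhds_unique tendsto_const_nhds ht₁).trans h0)
    · exact Or.inr (hα0 h)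
  have base₂ : t₂ ≠ 0 ∨ 0 < β := by
    rcases eq_or_ne l 0 with rfl | h
    · refine Or.inl fun h0 => ?_
      simp only [supDet_monomialFamily_zero _ hne₂, Real.one_rpow] at ht₂
      exact one_ne_zero ((tendsto_nhds_unique tendsto_const_nhds ht₂).trans h0)
    · exact Or.inr (hβ0 h)
  have hlow := (ht₁.rpow hα base₁).mul (ht₂.rpow hβ base₂)
  have hupp := (tendsto_factorial_rpow hr hN).mul hlow
  rw [one_mul] at hupp
  have hev : ∀ᶠ n in F, ∀ i, 2 ≤ N n i :=
    eventually_all.2 fun i => (hN i).eventually_ge_atTop 2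
  have key : ∀ᶠ n in F,
      (supDet (monomialFamily (fun i => N n (Fin.castAdd l i)) K₁) ^
          (1 / boxDegree fun i => N n (Fin.castAdd l i))) ^
          ((∑ i, ((N n (Fin.castAdd l i) : ℝ) - 1)) / ∑ i, ((N n i : ℝ) - 1)) *
        (supDet (monomialFamily (fun j => N n (Fin.natAdd k j)) K₂) ^
          (1 / boxDegree fun j => N n (Fin.natAdd k j))) ^
          ((∑ j, ((N n (Fin.natAdd k j) : ℝ) - 1)) / ∑ i, ((N n i : ℝ) - 1)) ≤
        supDet (monomialFamily (N n) (productSet K₁ K₂)) ^ (1 / boxDegree (N n)) ∧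
      supDet (monomialFamily (N n) (productSet K₁ K₂)) ^ (1 / boxDegree (N n)) ≤
        ((∏ i, N n i).factorial : ℝ) ^ (1 / boxDegree (N n)) *
        ((supDet (monomialFamily (fun i => N n (Fin.castAdd l i)) K₁) ^
          (1 / boxDegree fun i => N n (Fin.castAdd l i))) ^
          ((∑ i, ((N n (Fin.castAdd l i) : ℝ) - 1)) / ∑ i, ((N n i : ℝ) - 1)) *
        (supDet (monomialFamily (fun j => N n (Fin.natAdd k j)) K₂) ^
          (1 / boxDegree fun j => N n (Fin.natAdd k j))) ^
          ((∑ j, ((N n (Fin.natAdd k j) : ℝ) - 1)) / ∑ i, ((N n i : ℝ) - 1))) := by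
    filter_upwards [hev] with n hn
    have hprod : (∏ i, (N n i : ℝ)) =
        (∏ i, (N n (Fin.castAdd l i) : ℝ)) * ∏ j, (N n (Fin.natAdd k j) : ℝ) :=
      Fin.prod_univ_add _
    have hD : 0 ≤ boxDegree (N n) := by
      have : 0 ≤ ∑ i, ((N n i : ℝ) - 1) := Finset.sum_nonneg fun i _ => by
        have : (2 : ℝ) ≤ N n i := by exact_mod_cast hn i
        linarith
      unfold boxDegree
      positivity
    have hpos : ∀ i, 0 < N n i := fun i => by have := hn i; omega
    have : Nonempty (Fin (∏ i, N n (Fin.castAdd l i))) :=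
      ⟨⟨0, Finset.prod_pos fun i _ => hpos _⟩⟩
    have : Nonempty (Fin (∏ j, N n (Fin.natAdd k j))) :=
      ⟨⟨0, Finset.prod_pos fun i _ => hpos _⟩⟩
    rw [← rpow_exponent_split (fun i => hn _) hne₁ (M := ∏ j, N n (Fin.natAdd k j))
        (Finset.prod_pos fun i _ => hpos _).ne'
        (D := boxDegree (N n)) (by rw [boxDegree, hprod]; push_cast; rfl),
      ← rpow_exponent_split (fun i => hn _) hne₂ (M := ∏ i, N n (Fin.castAdd l i))
        (Finset.prod_pos fun i _ => hpos _).ne'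
        (D := boxDegree (N n)) (by rw [boxDegree, hprod]; push_cast; ring),
      ← Real.mul_rpow (pow_nonneg (supDet_nonneg _) _) (pow_nonneg (supDet_nonneg _) _),
      ← Real.mul_rpow (Nat.cast_nonneg _) (mul_nonneg (pow_nonneg (supDet_nonneg _) _)
        (pow_nonneg (supDet_nonneg _) _)), supDet_productSet]
    obtain ⟨h1, h2⟩ := supDet_tensor_bounds
      (monomialFamily (fun i => N n (Fin.castAdd l i)) K₁)
      (monomialFamily (fun j => N n (Fin.natAdd k j)) K₂)
      (continuous_monomialFamily _ _) (continuous_monomialFamily _ _)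
    rw [Fintype.card_fin, Fintype.card_fin] at h1
    rw [Fintype.card_prod, Fintype.card_fin, Fintype.card_fin, ← Fin.prod_univ_add] at h2
    exact ⟨Real.rpow_le_rpow (mul_nonneg (pow_nonneg (supDet_nonneg _) _)
        (pow_nonneg (supDet_nonneg _) _)) h1 (by positivity),
      Real.rpow_le_rpow (supDet_nonneg _) h2 (by positivity)⟩
  exact le_antisymm (le_of_tendsto_of_tendsto ht hupp (key.mono fun _ h => h.2))
    (le_of_tendsto_of_tendsto hlow ht (key.mono fun _ h => h.1))

/-! ### Reduction of the transfinite diameters to limits of suprema -/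

theorem isCompact_productSet {k l : ℕ} {K₁ : Set (Fin k → ℂ)} {K₂ : Set (Fin l → ℂ)}
    (hK₁ : IsCompact K₁) (hK₂ : IsCompact K₂) : IsCompact (productSet K₁ K₂) := by
  have hc : Continuous fun p : (Fin k → ℂ) × (Fin l → ℂ) => Fin.append p.1 p.2 := by
    refine continuous_pi fun i => ?_
    refine Fin.addCases (fun i => ?_) (fun i => ?_) i
    · simp only [Fin.append_left]; fun_prop
    · simp only [Fin.append_right]; fun_prop
  convert (hK₁.prod hK₂).image hc using 1
  ext z
  refine ⟨fun h => ⟨(_, _), h, Fin.append_castAdd_natAdd⟩, ?_⟩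
  rintro ⟨p, hp, rfl⟩
  simpa [productSet] using hp

theorem nonempty_productSet {k l : ℕ} {K₁ : Set (Fin k → ℂ)} {K₂ : Set (Fin l → ℂ)}
    (hne₁ : K₁.Nonempty) (hne₂ : K₂.Nonempty) : (productSet K₁ K₂).Nonempty :=
  have ⟨x, hx⟩ := hne₁
  have ⟨y, hy⟩ := hne₂
  ⟨((productSetEquiv K₁ K₂).symm (⟨x, hx⟩, ⟨y, hy⟩)).1, Subtype.prop _⟩

/-- Multiples of the product of the denominators are admissible and arbitrarily large. -/
theorem weightFilter_neBot {r : ℕ} (w : Fin r → ℚ) : (weightFilter w).NeBot := by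
  refine inf_principal_neBot_iff.2 fun U hU => ?_
  obtain ⟨a, ha⟩ := mem_atTop_sets.1 hU
  refine ⟨a * ∏ i, (w i).den, ha _ ?_, fun i =>
    (Finset.dvd_prod_of_mem _ (Finset.mem_univ i)).mul_left a⟩
  exact Nat.le_mul_of_pos_right _ (Finset.prod_pos fun i _ => (w i).den_pos)

theorem scaledWeights_eq {r : ℕ} {w : Fin r → ℚ} (hw : ∀ i, 0 < w i) {n : ℕ} {i : Fin r}
    (h : (w i).den ∣ n) : (scaledWeights w n i : ℝ) = (w i : ℝ) * n := by
  obtain ⟨c, rfl⟩ := h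
  have hnum : ((w i).num.toNat : ℤ) = (w i).num := Int.toNat_of_nonneg (Rat.num_nonneg.2 (hw i).le)
  have h1 : w i * ((w i).den * c : ℕ) = (((w i).num.toNat * c : ℕ) : ℚ) := by
    push_cast
    rw [← mul_assoc, Rat.mul_den_eq_num]
    congr 1
    exact_mod_cast hnum.symm
  have h2 : (scaledWeights w ((w i).den * c) i : ℚ) = w i * ((w i).den * c : ℕ) := by
    rw [scaledWeights, h1, Nat.floor_natCast]
  exact_mod_cast congrArg (Rat.cast : ℚ → ℝ) h2

theorem tendsto_scaledWeights {r : ℕ} {w : Fin r → ℚ} (hw : ∀ i, 0 < w i) (i : Fin r) :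
    Tendsto (fun n => scaledWeights w n i) atTop atTop :=
  tendsto_nat_floor_atTop.comp
    (tendsto_natCast_atTop_atTop.const_mul_atTop (hw i))

theorem IsWeightedTransfiniteDiameter.tendsto_supDet {r : ℕ} {w : Fin r → ℚ}
    {K : Set (Fin r → ℂ)} {t : ℝ} (h : IsWeightedTransfiniteDiameter w K t)
    (hw : ∀ i, 0 < w i) (hK : IsCompact K) (hne : K.Nonempty) :
    Tendsto (fun n => supDet (monomialFamily (scaledWeights w n) K) ^
      (1 / boxDegree (scaledWeights w n))) (weightFilter w) (𝓝 t) := by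
  refine Tendsto.congr' ?_ h
  have hev : ∀ᶠ n in weightFilter w, ∀ i, 1 ≤ scaledWeights w n i :=
    (eventually_all.2 fun i => (tendsto_scaledWeights hw i).eventually_ge_atTop 1).filter_mono
      inf_le_left
  filter_upwards [hev] with n hn
  rw [iSup_multiVandermonde_rpow _ hK hne (by positivity), vandermondeDegree_eq _ hn, boxDegree]

theorem IsTransfiniteDiameter.tendsto_supDet {r : ℕ} {K : Set (Fin r → ℂ)} {t : ℝ}
    (h : IsTransfiniteDiameter K t) (hK : IsCompact K) (hne : K.Nonempty) :
    Tendsto (fun n => supDet (monomialFamily (fun _ => n) K) ^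
      (1 / boxDegree fun _ : Fin r => n)) atTop (𝓝 t) := by
  refine Tendsto.congr' ?_ h
  filter_upwards [eventually_ge_atTop 1] with n hn
  have hn' : (0 : ℝ) ≤ (n : ℝ) - 1 := by
    have : (1 : ℝ) ≤ n := by exact_mod_cast hn
    linarith
  rw [iSup_multiVandermonde_rpow _ hK hne (by positivity), boxDegree]
  congr 2
  simp only [Finset.prod_const, Finset.sum_const, Finset.card_univ, Fintype.card_fin, nsmul_eq_mul]
  ring

/-- Along admissible `n` the floor is exact, so dividing both sums by `n` leaves summands `w i - 1 /
n`. The map `f` will be the inclusion of either block of coordinates. -/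
theorem tendsto_scaledWeights_ratio {r s : ℕ} (hr : 1 ≤ r) {w : Fin r → ℚ} (hw : ∀ i, 0 < w i)
    (f : Fin s → Fin r) :
    Tendsto (fun n => (∑ i, ((scaledWeights w n (f i) : ℝ) - 1)) /
      ∑ i, ((scaledWeights w n i : ℝ) - 1)) (weightFilter w)
      (𝓝 ((((∑ i, w (f i)) / ∑ i, w i : ℚ)) : ℝ)) := by
  have hinv : Tendsto (fun n : ℕ => (n : ℝ)⁻¹) (weightFilter w) (𝓝 0) :=
    tendsto_inv_atTop_nhds_zero_nat.mono_left inf_le_left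
  have hlim : ∀ {q : ℕ} (g : Fin q → Fin r),
      Tendsto (fun n : ℕ => ∑ i, ((w (g i) : ℝ) - (n : ℝ)⁻¹)) (weightFilter w)
        (𝓝 (∑ i, (w (g i) : ℝ))) := fun g =>
    tendsto_finsetSum _ fun i _ => by simpa using hinv.const_sub (w (g i) : ℝ)
  have hpos : (0 : ℝ) < ∑ i, (w i : ℝ) :=
    Finset.sum_pos (fun i _ => by exact_mod_cast hw i) ⟨⟨0, hr⟩, Finset.mem_univ _⟩
  have h := (hlim f).div (hlim fun i => i) hpos.ne'
  push_cast
  refine Tendsto.congr' ?_ h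
  have hdvd : ∀ᶠ n in weightFilter w, ∀ i, (w i).den ∣ n :=
    mem_inf_of_right (mem_principal_self _)
  have hge : ∀ᶠ n in weightFilter w, 1 ≤ n := (eventually_ge_atTop 1).filter_mono inf_le_left
  filter_upwards [hdvd, hge] with n hn h1
  have hn0 : (n : ℝ) ≠ 0 := by positivity
  have hs : ∀ {q : ℕ} (g : Fin q → Fin r), ∑ i, ((scaledWeights w n (g i) : ℝ) - 1) =
      (∑ i, ((w (g i) : ℝ) - (n : ℝ)⁻¹)) * n := fun g => by
    rw [Finset.sum_mul]
    refine Finset.sum_congr rfl fun i _ => ?_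
    rw [scaledWeights_eq hw (hn _), sub_mul, inv_mul_cancel₀ hn0]
  rw [hs f, hs fun i => i, mul_div_mul_right _ _ hn0]
  rfl

theorem mainTheorem5 (k l : ℕ) (hr : 1 ≤ k + l)
    (K₁ : Set (Fin k → ℂ)) (K₂ : Set (Fin l → ℂ))
    (hK₁ : IsCompact K₁) (hK₂ : IsCompact K₂) (hne₁ : K₁.Nonempty) (hne₂ : K₂.Nonempty) :
    (∀ w : Fin (k + l) → ℚ, (∀ i, 0 < w i) →
      ∀ t t₁ t₂ : ℝ,
        IsWeightedTransfiniteDiameter w (productSet K₁ K₂) t →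
        IsWeightedTransfiniteDiameter (fun i : Fin k => w (Fin.castAdd l i)) K₁ t₁ →
        IsWeightedTransfiniteDiameter (fun j : Fin l => w (Fin.natAdd k j)) K₂ t₂ →
        t = t₁ ^ (((∑ i : Fin k, w (Fin.castAdd l i)) / ∑ i, w i : ℚ) : ℝ) *
            t₂ ^ (((∑ j : Fin l, w (Fin.natAdd k j)) / ∑ i, w i : ℚ) : ℝ)) ∧
    (∀ t t₁ t₂ : ℝ,
      IsTransfiniteDiameter (productSet K₁ K₂) t →
      IsTransfiniteDiameter K₁ t₁ →
      IsTransfiniteDiameter K₂ t₂ →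
      t = t₁ ^ ((k : ℝ) / ((k + l : ℕ) : ℝ)) * t₂ ^ ((l : ℝ) / ((k + l : ℕ) : ℝ))) := by
  have hK := isCompact_productSet hK₁ hK₂
  have hne := nonempty_productSet hne₁ hne₂
  refine ⟨fun w hw t t₁ t₂ ht ht₁ ht₂ => ?_, fun t t₁ t₂ ht ht₁ ht₂ => ?_⟩
  · have := weightFilter_neBot w
    have hpos : 0 < ∑ i, w i := Finset.sum_pos (fun i _ => hw i) ⟨⟨0, hr⟩, Finset.mem_univ _⟩
    -- The limit for a factor runs over all `N` divisible by the denominators of its own weights; it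
    -- is restricted to the `N` admissible for all of `w`.
    have hle : ∀ {q : ℕ} (g : Fin q → Fin (k + l)),
        weightFilter w ≤ weightFilter fun i => w (g i) := fun g =>
      inf_le_inf_left _ (principal_mono.2 fun n hn i => hn (g i))
    refine eq_mul_of_tendsto_supDet (F := weightFilter w) hr hK₁ hK₂ hne₁ hne₂
      (fun i => (tendsto_scaledWeights hw i).mono_left inf_le_left)
      (tendsto_scaledWeights_ratio hr hw (Fin.castAdd l))
      (tendsto_scaledWeights_ratio hr hw (Fin.natAdd k)) (fun h => ?_) (fun h => ?_)
      (ht.tendsto_supDet hw hK hne)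
      ((ht₁.tendsto_supDet (fun _ => hw _) hK₁ hne₁).mono_left (hle _))
      ((ht₂.tendsto_supDet (fun _ => hw _) hK₂ hne₂).mono_left (hle _))
    · exact Rat.cast_pos.2 (div_pos (Finset.sum_pos (fun i _ => hw _)
        ⟨⟨0, Nat.pos_of_ne_zero h⟩, Finset.mem_univ _⟩) hpos)
    · exact Rat.cast_pos.2 (div_pos (Finset.sum_pos (fun i _ => hw _)
        ⟨⟨0, Nat.pos_of_ne_zero h⟩, Finset.mem_univ _⟩) hpos)
  -- With equal sizes the ratio is constant as soon as `n ≥ 2`; at `n = 1` it is `0 / 0`.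
  · have hratio : ∀ q : ℕ, Tendsto (fun n : ℕ => (∑ _i : Fin q, ((n : ℝ) - 1)) /
        ∑ _i : Fin (k + l), ((n : ℝ) - 1)) atTop (𝓝 ((q : ℝ) / ((k + l : ℕ) : ℝ))) := fun q => by
      refine tendsto_const_nhds.congr' ?_
      filter_upwards [eventually_ge_atTop 2] with n hn
      have hn' : (n : ℝ) - 1 ≠ 0 := by
        have : (2 : ℝ) ≤ n := by exact_mod_cast hn
        linarith
      simp only [Finset.sum_const, Finset.card_univ, Fintype.card_fin, nsmul_eq_mul]
      rw [mul_div_mul_right _ _ hn']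
    have hr' : (0 : ℝ) < ((k + l : ℕ) : ℝ) := by exact_mod_cast hr
    exact eq_mul_of_tendsto_supDet (N := fun n _ => n) hr hK₁ hK₂ hne₁ hne₂
      (fun _ => tendsto_id) (hratio k) (hratio l)
      (fun h => div_pos (by positivity) hr') (fun h => div_pos (by positivity) hr')
      (ht.tendsto_supDet hK hne) (ht₁.tendsto_supDet hK₁ hne₁) (ht₂.tendsto_supDet hK₂ hne₂)
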